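/- Let $k$ be a field of characteristic zero. For $n\ge 0$ let $P_n=k[x_1,\dots,x_n]$, and let $\prec$ be the degree reverse lexicographic order with $x_n\prec\cdots\prec x_1$. For a non-zero homogeneous ideal $I\subseteq P_n$: * $\operatorname{LT}(I)$ is the ideal generated by the leading terms of the non-zero elements of $I$, and $\deg(I,\prec)$ is the maximal (total) degree of an element of the reduced Gröbner basis of $I$ with respect to $\prec$. * A monomial ideal $J\subseteq P_n$ is quasi stable if for every term $m\in J$ and all integers $i,j,s$ with $1\le j<i\le n$, $s>0$ and $x_i^s\mid m$ there is $t\ge 0$ with $x_j^t m/x_i^s\in J$. The ideal $I$ is in quasi stable position if $\operatorname{LT}(I)$ is quasi stable. * $\dim(I)$ is the Krull dimension of $P_n/I$, and $\operatorname{depth}(I)$ is the maximal length of a regular sequence of linear forms on $P_n/I$. Suppose that $U(n,d,D)$ is a real-valued function of $n,d,D\in\mathbb{N}$ such that, for all $n$, $d$ and $D$, $\deg(I,\prec)\le U(n,d,D)$ holds for every non-zero ideal $I\subseteq P_n$ with $\dim(I)=D$ which is in quasi stable position and is generated by finitely many non-zero homogeneous polynomials of positive degree at most $d$. Then, for every non-zero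 ideal $I\subseteq P_n$ which is in quasi stable position, is generated by finitely many non-zero homogeneous polynomials of positive degree at most $d$, and has $\dim(I)=D$ and $\operatorname{depth}(I)=\lambda$, one has $\lambda\le D\le n$ and $$\deg(I,\prec)\le U(n-\lambda,d,D-\lambda).$$ -/

import Mathlib

open MvPolynomial

noncomputable section

/-- The set of exponent vectors of the terms in `x_0, …, x_{n-1}`, as a type synonym which carries
the degree reverse lexicographic order with `x_{n-1} ≺ ⋯ ≺ x_1 ≺ x_0`; see `DegRevLex.lt_iff`. -/
def DegRevLex (n : ℕ) : Type := Fin n →₀ ℕ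

namespace DegRevLex

variable {n : ℕ}

instance : AddCommMonoid (DegRevLex n) := inferInstanceAs (AddCommMonoid (Fin n →₀ ℕ))

/-- The underlying exponent vector. -/
def exps (a : DegRevLex n) : Fin n →₀ ℕ := a

/-- An exponent vector, regarded as an element of the type synonym. -/
def ofExps : (Fin n →₀ ℕ) ≃+ DegRevLex n := AddEquiv.refl _

/-- The total degree, followed by the exponents read from the last one to the first one and with
reversed order; the degree reverse lexicographic order compares these keys lexicographically. -/
def key (a : DegRevLex n) : ℕ ×ₗ Lex ((Fin n)ᵒᵈ → ℕᵒᵈ) :=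
  toLex (a.exps.degree, toLex (fun i => OrderDual.toDual (a.exps (OrderDual.ofDual i))))

lemma key_injective : Function.Injective (key (n := n)) := by
  intro a b h
  have h2 : (fun i : (Fin n)ᵒᵈ => OrderDual.toDual (a.exps (OrderDual.ofDual i)))
      = fun i => OrderDual.toDual (b.exps (OrderDual.ofDual i)) := (Prod.ext_iff.1 h).2
  exact Finsupp.ext fun i => congrFun h2 (OrderDual.toDual i)

instance : LinearOrder (DegRevLex n) := LinearOrder.lift' key key_injective

/-- `a ≺ b` iff `|a| < |b|`, or `|a| = |b|` and, at the last index where `a` and `b` differ,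
the exponent of `a` is the larger one. -/
lemma lt_iff {a b : DegRevLex n} : a < b ↔ a.exps.degree < b.exps.degree ∨
    a.exps.degree = b.exps.degree ∧
      ∃ i : Fin n, (∀ j, i < j → a.exps j = b.exps j) ∧ b.exps i < a.exps i := by
  change key a < key b ↔ _
  rw [key, key, Prod.Lex.toLex_lt_toLex]
  rfl

lemma exps_add (a b : DegRevLex n) : (a + b).exps = a.exps + b.exps := rfl

instance : IsOrderedAddMonoid (DegRevLex n) where
  add_le_add_left a b h c := by
    rcases h.eq_or_lt with rfl | h
    · exact le_rfl
    · refine le_of_lt ?_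
      rw [lt_iff] at h ⊢
      simpa [exps_add] using h

lemma le_of_exps_le {a b : DegRevLex n} (h : a.exps ≤ b.exps) : a ≤ b := by
  by_cases hab : a = b
  · exact hab.le
  refine le_of_lt (lt_iff.2 (Or.inl ?_))
  obtain ⟨c, hc⟩ := exists_add_of_le h
  have hc0 : c ≠ 0 := by
    rintro rfl
    exact hab (hc.trans (add_zero _)).symm
  have : c.degree ≠ 0 := fun h0 => hc0 ((Finsupp.degree_eq_zero_iff _).1 h0)
  have hd : b.exps.degree = a.exps.degree + c.degree := by rw [hc, map_add]
  omega

instance : WellFoundedLT (DegRevLex n) := by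
  have : WellQuasiOrderedLE (DegRevLex n) :=
    ⟨fun f => (wellQuasiOrdered_le (α := Fin n →₀ ℕ) f).imp fun _ h => h.imp fun _ h =>
      ⟨h.1, le_of_exps_le h.2⟩⟩
  infer_instance

end DegRevLex

/-- The degree reverse lexicographic order on the terms in `x_0, …, x_{n-1}` with
`x_{n-1} ≺ ⋯ ≺ x_0`, as a monomial order. -/
def degRevLex (n : ℕ) : MonomialOrder (Fin n) where
  syn := DegRevLex n
  toSyn := DegRevLex.ofExps
  toSyn_monotone _ _ h := DegRevLex.le_of_exps_le h

lemma degRevLex_lt_iff {n : ℕ} {a b : Fin n →₀ ℕ} :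
    (degRevLex n).toSyn a < (degRevLex n).toSyn b ↔ a.degree < b.degree ∨
      a.degree = b.degree ∧ ∃ i : Fin n, (∀ j, i < j → a j = b j) ∧ b i < a i :=
  DegRevLex.lt_iff

section Ideals

variable {k : Type*} [Field k] {n : ℕ}

/-- The leading ideal `LT(I)`, generated by the leading terms (power products, without
coefficients) of the non-zero elements of `I`. -/
def leadingIdeal (m : MonomialOrder (Fin n)) (I : Ideal (MvPolynomial (Fin n) k)) :
    Ideal (MvPolynomial (Fin n) k) :=
  Ideal.span {p | ∃ f ∈ I, f ≠ 0 ∧ p = monomial (m.degree f) 1}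

/-- `G` is the reduced Gröbner basis of `I`: a finite subset of `I` whose leading terms generate
`LT(I)`, consisting of monic polynomials, such that no term occurring in an element of `G` is
divisible by the leading term of another element of `G`. -/
structure IsReducedGroebnerBasis (m : MonomialOrder (Fin n))
    (I : Ideal (MvPolynomial (Fin n) k)) (G : Finset (MvPolynomial (Fin n) k)) : Prop where
  subset : ∀ g ∈ G, g ∈ I
  span_eq : leadingIdeal m I =
    Ideal.span ((fun g => monomial (m.degree g) (1 : k)) '' (G : Set (MvPolynomial (Fin n) k)))
  monic : ∀ g ∈ G, m.Monic g
  reduced : ∀ g ∈ G, ∀ g' ∈ G, g' ≠ g → ∀ a ∈ g.support, ¬ m.degree g' ≤ a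

/-- `deg(I, ≺) = e`: the maximal degree of an element of the reduced Gröbner basis of `I`
is `e`. -/
def IsGroebnerDegree (m : MonomialOrder (Fin n)) (I : Ideal (MvPolynomial (Fin n) k))
    (e : ℕ) : Prop :=
  ∃ G : Finset (MvPolynomial (Fin n) k), IsReducedGroebnerBasis m I G ∧
    IsGreatest {s | ∃ g ∈ G, s = g.totalDegree} e

/-- Quasi stability (of a monomial ideal `J`): for every term `m ∈ J`, all `j < i` and all `s > 0`
with `x_i ^ s ∣ m` there is `t ≥ 0` with `x_j ^ t * m / x_i ^ s ∈ J`. -/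
def IsQuasiStable (J : Ideal (MvPolynomial (Fin n) k)) : Prop :=
  ∀ a : Fin n →₀ ℕ, monomial a (1 : k) ∈ J → ∀ i j : Fin n, j < i → ∀ s : ℕ, 0 < s → s ≤ a i →
    ∃ t : ℕ, monomial (a - Finsupp.single i s + Finsupp.single j t) (1 : k) ∈ J

/-- `I` is in quasi stable position: its leading ideal for the degree reverse lexicographic order
is quasi stable. -/
def InQuasiStablePosition (I : Ideal (MvPolynomial (Fin n) k)) : Prop :=
  IsQuasiStable (leadingIdeal (degRevLex n) I)

/-- `I` is generated by finitely many non-zero homogeneous polynomials of positive degree at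
most `d`. -/
def IsGeneratedInDegreeLE (I : Ideal (MvPolynomial (Fin n) k)) (d : ℕ) : Prop :=
  ∃ F : Finset (MvPolynomial (Fin n) k),
    (∀ f ∈ F, f ≠ 0 ∧ ∃ e : ℕ, 0 < e ∧ e ≤ d ∧ f.IsHomogeneous e) ∧
    I = Ideal.span (F : Set (MvPolynomial (Fin n) k))

/-- `depth(I) = l`: the maximal length of a regular sequence of linear forms on the factor ring
by `I` is `l`. -/
def IsDepth (I : Ideal (MvPolynomial (Fin n) k)) (l : ℕ) : Prop :=
  IsGreatest {r : ℕ | ∃ ys : List (MvPolynomial (Fin n) k), ys.length = r ∧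
    (∀ y ∈ ys, y.IsHomogeneous 1) ∧
    RingTheory.Sequence.IsRegular (MvPolynomial (Fin n) k ⧸ I) ys} l

end Ideals

end

/-! The proof is by induction on the length of a regular sequence modulo `I` in the ideal of the
variables; each step sets the last variable to zero. If the sequence is non-empty, its first element
`y` is a non-zero divisor modulo `I`. Quasi stability makes `I : x_n` and `I` agree in all large
degrees (`finite_of_quasiStable`), and cancelling a high power of `y` shows that `x_n` is itself a
non-zero divisor (`InQuasiStablePosition.mem_of_X_last_mul_mem`). In degree reverse lexicographic
order, `x_n` divides a form as soon as it divides its leading term. Hence no minimal generator of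
`LT(I)` involves `x_n`, and setting `x_n = 0` turns the reduced Gröbner basis into that of the image
ideal without changing degrees (`IsHomogeneousIdeal.isGroebnerDegree_map_dropLast`). Quasi stable
position and the bound on the generators survive. The dimension drops by one, being the number of
variables without a power in `LT(I)` (`InQuasiStablePosition.ringKrullDim_quotient`), and a regular
sequence one shorter exists by the Ext criterion (`exists_isRegular_quotSMulTop`). Once the sequence
is used up, the bound `U` applies. -/

/-! ### Leading exponents and the leading ideal. -/

section LeadingExponents

variable {k : Type*} [Field k] {n : ℕ}

/-- The exponent vectors of the leading terms of the non-zero elements of `I`. -/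
def leadExps (m : MonomialOrder (Fin n)) (I : Ideal (MvPolynomial (Fin n) k)) :
    Set (Fin n →₀ ℕ) :=
  {a | ∃ f ∈ I, f ≠ 0 ∧ m.degree f = a}

lemma leadExps_mono_mem {m : MonomialOrder (Fin n)} {I : Ideal (MvPolynomial (Fin n) k)}
    {a b : Fin n →₀ ℕ} (ha : a ∈ leadExps m I) (hab : a ≤ b) : b ∈ leadExps m I := by
  obtain ⟨f, hf, hf0, rfl⟩ := ha
  have h1 : monomial (b - m.degree f) (1 : k) ≠ 0 := by simp
  refine ⟨monomial (b - m.degree f) 1 * f, I.mul_mem_left _ hf, mul_ne_zero h1 hf0, ?_⟩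
  classical
  rw [m.degree_mul h1 hf0, m.degree_monomial, if_neg one_ne_zero, tsub_add_cancel_of_le hab]

lemma leadingIdeal_eq_span (m : MonomialOrder (Fin n)) (I : Ideal (MvPolynomial (Fin n) k)) :
    leadingIdeal m I = Ideal.span ((fun s => monomial s (1 : k)) '' leadExps m I) := by
  unfold leadingIdeal
  congr 1
  ext p
  constructor
  · rintro ⟨f, hf, hf0, rfl⟩
    exact ⟨_, ⟨f, hf, hf0, rfl⟩, rfl⟩
  · rintro ⟨_, ⟨f, hf, hf0, rfl⟩, rfl⟩
    exact ⟨f, hf, hf0, rfl⟩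

/-- Leading exponents are closed under passing to multiples, so the leading ideal contains no
further terms. -/
lemma monomial_mem_leadingIdeal_iff {m : MonomialOrder (Fin n)}
    {I : Ideal (MvPolynomial (Fin n) k)} {a : Fin n →₀ ℕ} :
    monomial a (1 : k) ∈ leadingIdeal m I ↔ a ∈ leadExps m I := by
  classical
  rw [leadingIdeal_eq_span, mem_ideal_span_monomial_image]
  simp only [support_monomial, one_ne_zero, if_false, Finset.mem_singleton, forall_eq]
  exact ⟨fun ⟨s, hs, h⟩ => leadExps_mono_mem hs h, fun h => ⟨a, h, le_rfl⟩⟩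

lemma zero_notMem_leadExps {m : MonomialOrder (Fin n)} {I : Ideal (MvPolynomial (Fin n) k)}
    (hI : I ≠ ⊤) : (0 : Fin n →₀ ℕ) ∉ leadExps m I := by
  rintro ⟨f, hf, hf0, h⟩
  rw [m.eq_C_of_degree_eq_zero h] at hf
  refine hI (I.eq_top_of_isUnit_mem hf ?_)
  exact (isUnit_iff_ne_zero.2 (m.leadingCoeff_ne_zero_iff.2 hf0)).map C

lemma leadExps_nonempty {m : MonomialOrder (Fin n)} {I : Ideal (MvPolynomial (Fin n) k)}
    (hI : I ≠ ⊥) : (leadExps m I).Nonempty := by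
  obtain ⟨f, hf, hf0⟩ := I.ne_bot_iff.1 hI
  exact ⟨_, f, hf, hf0, rfl⟩

lemma MonomialOrder.degree_eq_of_mem_support {σ R : Type*} [CommSemiring R] (m : MonomialOrder σ)
    {f : MvPolynomial σ R} {a : σ →₀ ℕ} (ha : a ∈ f.support)
    (h : ∀ c ∈ f.support, m.toSyn c ≤ m.toSyn a) : m.degree f = a :=
  m.toSyn.injective (le_antisymm (m.degree_le_iff.2 h) (m.le_degree ha))

lemma inQuasiStablePosition_iff {I : Ideal (MvPolynomial (Fin n) k)} :
    InQuasiStablePosition I ↔ ∀ a ∈ leadExps (degRevLex n) I, ∀ i j : Fin n, j < i →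
      ∀ s : ℕ, 0 < s → s ≤ a i →
        ∃ t : ℕ, a - Finsupp.single i s + Finsupp.single j t ∈ leadExps (degRevLex n) I := by
  simp only [InQuasiStablePosition, IsQuasiStable, monomial_mem_leadingIdeal_iff]

end LeadingExponents

/-! ### Homogeneous ideals under the degree reverse lexicographic order. -/

section Homogeneous

variable {k : Type*} [Field k] {n : ℕ}

lemma degree_le_of_degRevLex_le {a b : Fin n →₀ ℕ}
    (h : (degRevLex n).toSyn a ≤ (degRevLex n).toSyn b) : a.degree ≤ b.degree := by
  by_contra! hlt
  exact h.not_gt (degRevLex_lt_iff.2 (Or.inl hlt))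

lemma totalDegree_eq_degree_degRevLex (f : MvPolynomial (Fin n) k) :
    f.totalDegree = ((degRevLex n).degree f).degree := by
  by_cases hf : f = 0
  · simp [hf]
  apply le_antisymm
  · exact Finset.sup_le fun c hc => degree_le_of_degRevLex_le ((degRevLex n).le_degree hc)
  · exact le_totalDegree ((degRevLex n).degree_mem_support hf)

lemma MvPolynomial.IsHomogeneous.degree_eq_of_mem_support {σ R : Type*} [CommSemiring R]
    {f : MvPolynomial σ R} {d : ℕ} (hf : f.IsHomogeneous d) {a : σ →₀ ℕ} (ha : a ∈ f.support) :
    a.degree = d := by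
  by_contra h
  exact mem_support_iff.1 ha (hf.coeff_eq_zero h)

/-- `I` contains all homogeneous components of its elements. -/
def IsHomogeneousIdeal (I : Ideal (MvPolynomial (Fin n) k)) : Prop :=
  ∀ f ∈ I, ∀ i, homogeneousComponent i f ∈ I

attribute [local instance] MvPolynomial.gradedAlgebra in
lemma isHomogeneousIdeal_span {s : Set (MvPolynomial (Fin n) k)}
    (h : ∀ f ∈ s, ∃ e : ℕ, f.IsHomogeneous e) : IsHomogeneousIdeal (Ideal.span s) := fun _ hf i =>
  homogeneousComponent_mem_of_mem
    (Ideal.homogeneous_span (homogeneousSubmodule (Fin n) k) s fun g hg => h g hg) hf i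

lemma IsGeneratedInDegreeLE.isHomogeneousIdeal {I : Ideal (MvPolynomial (Fin n) k)} {d : ℕ}
    (h : IsGeneratedInDegreeLE I d) : IsHomogeneousIdeal I := by
  obtain ⟨F, hF, rfl⟩ := h
  refine isHomogeneousIdeal_span fun f hf => ?_
  obtain ⟨-, e, -, -, he⟩ := hF f hf
  exact ⟨e, he⟩

lemma mem_idealOfVars_iff {σ R : Type*} [CommSemiring R] {f : MvPolynomial σ R} :
    f ∈ idealOfVars σ R ↔ constantCoeff f = 0 := by
  rw [← pow_one (idealOfVars σ R), mem_pow_idealOfVars_iff', constantCoeff_eq]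
  simp [Finsupp.degree_eq_zero_iff]

lemma MvPolynomial.IsHomogeneous.mem_idealOfVars {σ R : Type*} [CommSemiring R]
    {f : MvPolynomial σ R} {e : ℕ} (hf : f.IsHomogeneous e) (he : 0 < e) :
    f ∈ idealOfVars σ R :=
  mem_idealOfVars_iff.2 (hf.coeff_eq_zero (by simpa using he.ne))

lemma IsGeneratedInDegreeLE.le_idealOfVars {I : Ideal (MvPolynomial (Fin n) k)} {d : ℕ}
    (h : IsGeneratedInDegreeLE I d) : I ≤ idealOfVars (Fin n) k := by
  obtain ⟨F, hF, rfl⟩ := h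
  refine Ideal.span_le.2 fun f hf => ?_
  obtain ⟨-, e, he0, -, he⟩ := hF f hf
  exact he.mem_idealOfVars he0

lemma idealOfVars_ne_top : idealOfVars (Fin n) k ≠ ⊤ := by
  rw [Ideal.ne_top_iff_one, mem_idealOfVars_iff, map_one]
  exact one_ne_zero

lemma IsHomogeneousIdeal.exists_isHomogeneous {I : Ideal (MvPolynomial (Fin n) k)}
    (hI : IsHomogeneousIdeal I) {a : Fin n →₀ ℕ} (ha : a ∈ leadExps (degRevLex n) I) :
    ∃ f ∈ I, f ≠ 0 ∧ (degRevLex n).degree f = a ∧ f.IsHomogeneous a.degree := by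
  obtain ⟨f, hf, hf0, rfl⟩ := ha
  set a := (degRevLex n).degree f
  have hmem : a ∈ (homogeneousComponent a.degree f).support := by
    rw [mem_support_iff, coeff_homogeneousComponent, if_pos rfl]
    exact mem_support_iff.1 ((degRevLex n).degree_mem_support hf0)
  refine ⟨_, hI f hf a.degree, ?_, ?_, homogeneousComponent_isHomogeneous _ _⟩
  · exact fun h => by simp [h] at hmem
  · refine (degRevLex n).degree_eq_of_mem_support hmem fun c hc => ?_
    rw [mem_support_iff, coeff_homogeneousComponent] at hc
    exact (degRevLex n).le_degree (mem_support_iff.2 fun h => hc (by simp [h]))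

/-- If all leading terms of the homogeneous polynomials of degree `d` in `K` are leading terms
of `I ≤ K`, then `I` and `K` agree in degree `d`. -/
lemma IsHomogeneousIdeal.mem_of_leadExps {I K : Ideal (MvPolynomial (Fin n) k)}
    (hI : IsHomogeneousIdeal I) (hIK : I ≤ K) {d : ℕ}
    (h : ∀ f ∈ K, f ≠ 0 → f.IsHomogeneous d →
      (degRevLex n).degree f ∈ leadExps (degRevLex n) I)
    {f : MvPolynomial (Fin n) k} (hf : f ∈ K) (hfd : f.IsHomogeneous d) : f ∈ I := by
  set m := degRevLex n
  induction hs : m.toSyn (m.degree f) using WellFoundedLT.induction generalizing f with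
  | ind s ih =>
    subst hs
    by_cases hf0 : f = 0
    · simp [hf0]
    obtain ⟨g, hg, hg0, hgf, hgd⟩ := hI.exists_isHomogeneous (h f hf hf0 hfd)
    have hdeg : (m.degree f).degree = d :=
      hfd.degree_eq_of_mem_support (m.degree_mem_support hf0)
    rw [hdeg] at hgd
    set c : k := m.leadingCoeff f / m.leadingCoeff g
    have hr : f - C c * g ∈ I := by
      by_cases hr0 : f - C c * g = 0
      · simp [hr0]
      have hrd : (f - C c * g).IsHomogeneous d := hfd.sub (hgd.C_mul c)
      refine ih _ (lt_of_le_of_ne (m.degree_le_iff.2 fun a ha => ?_) fun he => ?_)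
        (K.sub_mem hf (K.mul_mem_left _ (hIK hg))) hrd rfl
      · rw [mem_support_iff, coeff_sub, coeff_C_mul] at ha
        by_cases hfa : coeff a f = 0
        · have : coeff a g ≠ 0 := fun h0 => ha (by simp [hfa, h0])
          rw [← show m.degree g = m.degree f from hgf]
          exact m.le_degree (mem_support_iff.2 this)
        · exact m.le_degree (mem_support_iff.2 hfa)
      · have h1 := mem_support_iff.1 (m.degree_mem_support hr0)
        rw [m.toSyn.injective he, coeff_sub, coeff_C_mul] at h1
        apply h1
        have h2 : coeff (m.degree f) g = m.leadingCoeff g := by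
          rw [MonomialOrder.leadingCoeff, show m.degree g = m.degree f from hgf]
        rw [h2, div_mul_cancel₀ _ (m.leadingCoeff_ne_zero_iff.2 hg0)]
        simp [MonomialOrder.leadingCoeff]
    simpa using I.add_mem hr (I.mul_mem_left (C c) hg)

end Homogeneous

/-! ### Regularity of the last variable. -/

section LastVariable

variable {k : Type*} [Field k] {n : ℕ}

/-- An infinite set of such terms would contain, by Dickson's lemma, an ascending sequence `b 0 ≤ b
1 ≤ …` of distinct terms. Trading the extra `x_n` in `b 0 * x_n` for a power of `x_j` puts some `b 0
* x_j ^ t j` into `E` for every `j`. As no `b i` lies in the up-closed set `E`, all of them are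
bounded by `b 0 + t`, which leaves finitely many. -/
lemma finite_of_quasiStable {E : Set (Fin (n + 1) →₀ ℕ)}
    (hqs : ∀ a ∈ E, ∀ i j : Fin (n + 1), j < i → ∀ s : ℕ, 0 < s → s ≤ a i →
      ∃ t : ℕ, a - Finsupp.single i s + Finsupp.single j t ∈ E)
    (hup : ∀ a ∈ E, ∀ b, a ≤ b → b ∈ E) :
    {b | b ∉ E ∧ b + Finsupp.single (Fin.last n) 1 ∈ E}.Finite := by
  by_contra hB
  rw [← Set.Infinite] at hB
  set f := hB.natEmbedding
  obtain ⟨g, hg⟩ := (wellQuasiOrdered_le (α := Fin (n + 1) →₀ ℕ)).exists_monotone_subseq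
    fun i => (f i : Fin (n + 1) →₀ ℕ)
  set b := fun i => (f (g i) : Fin (n + 1) →₀ ℕ)
  have hb : Function.Injective b :=
    Subtype.val_injective.comp (f.injective.comp g.injective)
  have key : ∀ j, ∃ t : ℕ, b 0 + Finsupp.single j t ∈ E := by
    intro j
    have h0 : b 0 + Finsupp.single (Fin.last n) 1 ∈ E := (f (g 0)).2.2
    rcases (Fin.le_last j).eq_or_lt with rfl | hj
    · exact ⟨1, h0⟩
    · obtain ⟨t, ht⟩ := hqs _ h0 (Fin.last n) j hj 1 one_pos (by simp)
      exact ⟨t, by simpa using ht⟩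
  choose t ht using key
  refine Set.infinite_range_of_injective hb
    ((Set.finite_Iic (b 0 + Finsupp.equivFunOnFinite.symm t)).subset ?_)
  rintro _ ⟨i, rfl⟩ j
  by_contra! hlt
  refine (f (g i)).2.1 (hup _ (ht j) _ fun l => ?_)
  rcases eq_or_ne l j with rfl | hl
  · simpa using hlt.le
  · simpa [Finsupp.single_eq_of_ne hl] using hg 0 i (Nat.zero_le i) l

lemma homogeneousComponent_X_mul {σ R : Type*} [CommSemiring R] (i : ℕ) (x : σ)
    (f : MvPolynomial σ R) :
    homogeneousComponent (i + 1) (X x * f) = X x * homogeneousComponent i f := by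
  classical
  ext a
  rw [coeff_homogeneousComponent, coeff_X_mul', coeff_X_mul', coeff_homogeneousComponent]
  by_cases hx : x ∈ a.support
  · have hle : Finsupp.single x 1 ≤ a := by
      simpa [Nat.one_le_iff_ne_zero] using hx
    have hd : a.degree = (a - Finsupp.single x 1).degree + 1 := by
      conv_lhs => rw [← tsub_add_cancel_of_le hle]
      rw [map_add, Finsupp.degree_single]
    simp [hx, hd]
  · simp [hx]

/-- If some polynomial without constant term is a non-zero divisor modulo a homogeneous ideal in
quasi stable position, then so is the last variable. -/
lemma InQuasiStablePosition.mem_of_X_last_mul_mem {I : Ideal (MvPolynomial (Fin (n + 1)) k)}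
    (hqs : InQuasiStablePosition I) (hI : IsHomogeneousIdeal I)
    {y : MvPolynomial (Fin (n + 1)) k} (hy : y ∈ idealOfVars (Fin (n + 1)) k)
    (hreg : ∀ f, y * f ∈ I → f ∈ I) {f : MvPolynomial (Fin (n + 1)) k}
    (hf : X (Fin.last n) * f ∈ I) : f ∈ I := by
  classical
  set m := degRevLex (n + 1)
  -- This is the colon ideal `I : x_n`.
  let K : Ideal (MvPolynomial (Fin (n + 1)) k) :=
    Submodule.comap (LinearMap.lsmul _ _ (X (Fin.last n))) I
  have hK : ∀ {g}, g ∈ K ↔ X (Fin.last n) * g ∈ I := Iff.rfl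
  have hIK : I ≤ K := fun g hg => I.mul_mem_left _ hg
  rw [inQuasiStablePosition_iff] at hqs
  have hfin := finite_of_quasiStable hqs fun a ha b hab => leadExps_mono_mem ha hab
  obtain ⟨N, hN⟩ := (hfin.image Finsupp.degree).bddAbove
  -- A leading term of `K` outside `LT(I)` enters `LT(I)` after multiplication by `x_n`, so it
  -- belongs to the finite set and has degree at most `N`.
  have hlarge : ∀ d, N < d → ∀ g ∈ K, g.IsHomogeneous d → g ∈ I := by
    intro d hd g hg hgd
    refine hI.mem_of_leadExps hIK (fun p hp hp0 hpd => ?_) hg hgd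
    by_contra hlt
    have hX : (X (Fin.last n) : MvPolynomial (Fin (n + 1)) k) ≠ 0 := X_ne_zero _
    have := hN ⟨m.degree p, ⟨hlt, X (Fin.last n) * p, hp, mul_ne_zero hX hp0, by
      rw [m.degree_mul hX hp0, m.degree_X]; exact add_comm _ _⟩, rfl⟩
    rw [hpd.degree_eq_of_mem_support (m.degree_mem_support hp0)] at this
    omega
  have hpow : ∀ j : ℕ, y ^ j * f ∈ I → f ∈ I := by
    intro j
    induction j with
    | zero => simp
    | succ j ih => exact fun h => ih (hreg _ (by rwa [← mul_assoc, ← pow_succ']))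
  -- All terms of `y ^ (N + 1) * f` have degree above `N`, so its homogeneous components, which lie
  -- in `K`, lie in `I`.
  apply hpow (N + 1)
  have hyf : y ^ (N + 1) * f ∈ idealOfVars (Fin (n + 1)) k ^ (N + 1) :=
    Ideal.mul_mem_right _ _ (Ideal.pow_mem_pow hy _)
  rw [mem_pow_idealOfVars_iff] at hyf
  rw [← sum_homogeneousComponent (y ^ (N + 1) * f)]
  refine I.sum_mem fun i _ => ?_
  by_cases hi : N < i
  · refine hlarge i hi _ ?_ (homogeneousComponent_isHomogeneous _ _)
    rw [hK, ← homogeneousComponent_X_mul]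
    exact hI _ (hK.1 (K.mul_mem_left _ hf)) _
  · rw [homogeneousComponent_eq_zero']
    · exact I.zero_mem
    · intro c hc
      have := hyf c hc
      omega

end LastVariable

/-! ### Setting the last variable to zero. -/

section DropLast

variable {k : Type*} [Field k] {n : ℕ}

/-- The exponent vector `a` with an exponent `0` appended. -/
noncomputable abbrev snocZero (a : Fin n →₀ ℕ) : Fin (n + 1) →₀ ℕ := a.mapDomain Fin.castSucc

/-- The substitution of `0` for the last variable. -/
noncomputable abbrev dropLast (k : Type*) [Field k] (n : ℕ) :
    MvPolynomial (Fin (n + 1)) k →ₐ[k] MvPolynomial (Fin n) k :=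
  killCompl (Fin.castSucc_injective n)

@[simp]
lemma snocZero_castSucc (a : Fin n →₀ ℕ) (i : Fin n) : snocZero a i.castSucc = a i :=
  Finsupp.mapDomain_apply (Fin.castSucc_injective n) a i

@[simp]
lemma snocZero_last (a : Fin n →₀ ℕ) : snocZero a (Fin.last n) = 0 :=
  Finsupp.mapDomain_of_notMem_range a _ (by simp)

lemma snocZero_comapDomain {a : Fin (n + 1) →₀ ℕ} (ha : a (Fin.last n) = 0) :
    snocZero (a.comapDomain Fin.castSucc (Fin.castSucc_injective n).injOn) = a := by
  ext i
  induction i using Fin.lastCases <;> simp [ha]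

lemma snocZero_le_iff {a b : Fin n →₀ ℕ} : snocZero a ≤ snocZero b ↔ a ≤ b := by
  constructor
  · intro h i
    simpa using h i.castSucc
  · intro h i
    induction i using Fin.lastCases with
    | last => simp
    | cast i => simpa using h i

lemma degRevLex_snocZero_le_iff {a b : Fin n →₀ ℕ} :
    (degRevLex (n + 1)).toSyn (snocZero a) ≤ (degRevLex (n + 1)).toSyn (snocZero b) ↔
      (degRevLex n).toSyn a ≤ (degRevLex n).toSyn b := by
  rw [← not_lt, ← not_lt, not_iff_not, degRevLex_lt_iff, degRevLex_lt_iff,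
    Finsupp.degree_mapDomain, Finsupp.degree_mapDomain]
  refine or_congr_right (and_congr_right fun _ => ?_)
  constructor
  · rintro ⟨i, hi, hlt⟩
    induction i using Fin.lastCases with
    | last => simp at hlt
    | cast i =>
      exact ⟨i, fun j hj => by simpa using hi j.castSucc (by simpa using hj), by simpa using hlt⟩
  · rintro ⟨i, hi, hlt⟩
    refine ⟨i.castSucc, fun j hj => ?_, by simpa using hlt⟩
    induction j using Fin.lastCases with
    | last => simp
    | cast j => simpa using hi j (by simpa using hj)

lemma dropLast_surjective : Function.Surjective (dropLast k n) := fun p =>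
  ⟨rename Fin.castSucc p, killCompl_rename_app _ p⟩

lemma dropLast_homogeneousComponent (f : MvPolynomial (Fin (n + 1)) k) (d : ℕ) :
    dropLast k n (homogeneousComponent d f) = homogeneousComponent d (dropLast k n f) := by
  ext a
  rw [coeff_homogeneousComponent, coeff_killCompl, coeff_killCompl, coeff_homogeneousComponent,
    Finsupp.degree_mapDomain]

lemma MvPolynomial.IsHomogeneous.dropLast {f : MvPolynomial (Fin (n + 1)) k} {d : ℕ}
    (hf : f.IsHomogeneous d) : (dropLast k n f).IsHomogeneous d := by
  rw [← homogeneousComponent_eq_self hf, dropLast_homogeneousComponent]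
  exact homogeneousComponent_isHomogeneous _ _

lemma dropLast_ne_zero {f : MvPolynomial (Fin (n + 1)) k} {a : Fin n →₀ ℕ} (hf : f ≠ 0)
    (ha : (degRevLex (n + 1)).degree f = snocZero a) : dropLast k n f ≠ 0 := fun h => by
  have := (degRevLex (n + 1)).degree_mem_support hf
  rw [ha, mem_support_iff, ← coeff_killCompl (hf := Fin.castSucc_injective n)] at this
  exact this (by rw [h, coeff_zero])

lemma degree_dropLast {f : MvPolynomial (Fin (n + 1)) k} {a : Fin n →₀ ℕ} (hf : f ≠ 0)
    (ha : (degRevLex (n + 1)).degree f = snocZero a) :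
    (degRevLex n).degree (dropLast k n f) = a := by
  refine (degRevLex n).degree_eq_of_mem_support ?_ fun c hc => ?_
  · have := (degRevLex (n + 1)).degree_mem_support hf
    rw [ha, mem_support_iff] at this
    rwa [mem_support_iff, coeff_killCompl]
  · rw [mem_support_iff, coeff_killCompl, ← mem_support_iff] at hc
    rw [← degRevLex_snocZero_le_iff, ← ha]
    exact (degRevLex (n + 1)).le_degree hc

/-- Among terms of equal degree, those free of the last variable exceed those containing it; a
non-zero specialization means that a term of the former kind occurs in `f`. -/
lemma degree_last_eq_zero {f : MvPolynomial (Fin (n + 1)) k} {d : ℕ} (hf : f.IsHomogeneous d)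
    (h : dropLast k n f ≠ 0) : (degRevLex (n + 1)).degree f (Fin.last n) = 0 := by
  obtain ⟨a, ha⟩ := ne_zero_iff.1 h
  rw [coeff_killCompl, ← mem_support_iff] at ha
  have hf0 : f ≠ 0 := by
    rintro rfl
    simp at ha
  rcases ((degRevLex (n + 1)).le_degree ha).eq_or_lt with he | hlt
  · rw [← (degRevLex (n + 1)).toSyn.injective he]
    exact snocZero_last a
  · rcases degRevLex_lt_iff.1 hlt with hlt | ⟨-, i, hi, hlt⟩
    · rw [hf.degree_eq_of_mem_support ha, hf.degree_eq_of_mem_support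
        ((degRevLex (n + 1)).degree_mem_support hf0)] at hlt
      exact absurd hlt (lt_irrefl d)
    · induction i using Fin.lastCases with
      | last => simp at hlt
      | cast i =>
        rw [← hi _ (Fin.castSucc_lt_last i)]
        exact snocZero_last a

lemma X_last_dvd_iff {f : MvPolynomial (Fin (n + 1)) k} :
    X (Fin.last n) ∣ f ↔ dropLast k n f = 0 := by
  have h := mem_ideal_span_X_image (x := f) (s := {Fin.last n})
  rw [Set.image_singleton, Ideal.mem_span_singleton] at h
  rw [h, eq_zero_iff]
  simp only [Set.mem_singleton_iff, exists_eq_left, coeff_killCompl]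
  constructor
  · intro h a
    by_contra ha
    exact h _ (mem_support_iff.2 ha) (snocZero_last a)
  · intro h a ha ha0
    rw [← snocZero_comapDomain ha0, mem_support_iff] at ha
    exact ha (h _)

lemma mem_map_dropLast {I : Ideal (MvPolynomial (Fin (n + 1)) k)} {g : MvPolynomial (Fin n) k} :
    g ∈ I.map (dropLast k n) ↔ ∃ f ∈ I, dropLast k n f = g :=
  Ideal.mem_map_iff_of_surjective _ dropLast_surjective

lemma IsHomogeneousIdeal.map_dropLast {I : Ideal (MvPolynomial (Fin (n + 1)) k)}
    (hI : IsHomogeneousIdeal I) : IsHomogeneousIdeal (I.map (dropLast k n)) := by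
  intro g hg i
  obtain ⟨f, hf, rfl⟩ := mem_map_dropLast.1 hg
  exact mem_map_dropLast.2 ⟨_, hI f hf i, dropLast_homogeneousComponent f i⟩

/-- A leading term free of `x_n` survives the specialization. Conversely, a form in the image lifts
to a form of the same degree in `I`, whose leading term is free of `x_n` by `degree_last_eq_zero`.
-/
lemma IsHomogeneousIdeal.mem_leadExps_map_dropLast {I : Ideal (MvPolynomial (Fin (n + 1)) k)}
    (hI : IsHomogeneousIdeal I) {a : Fin n →₀ ℕ} :
    a ∈ leadExps (degRevLex n) (I.map (dropLast k n)) ↔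
      snocZero a ∈ leadExps (degRevLex (n + 1)) I := by
  constructor
  · intro ha
    obtain ⟨g, hg, hg0, hga, hgd⟩ := hI.map_dropLast.exists_isHomogeneous ha
    obtain ⟨f, hf, rfl⟩ := mem_map_dropLast.1 hg
    have hfg : dropLast k n (homogeneousComponent a.degree f) = dropLast k n f := by
      rw [dropLast_homogeneousComponent, homogeneousComponent_eq_self hgd]
    have hlast := degree_last_eq_zero
      (homogeneousComponent_isHomogeneous a.degree f) (by rwa [hfg])
    have hf0 : homogeneousComponent a.degree f ≠ 0 := fun h => hg0 (by rw [← hfg, h, map_zero])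
    refine ⟨_, hI f hf _, hf0, ?_⟩
    have h1 := (snocZero_comapDomain hlast).symm
    rw [h1, ← degree_dropLast hf0 h1, hfg, hga]
  · rintro ⟨f, hf, hf0, ha⟩
    exact ⟨_, Ideal.mem_map_of_mem _ hf, dropLast_ne_zero hf0 ha, degree_dropLast hf0 ha⟩

/-- When `x_n` divides the leading term of a form in `I`, it divides the form and can be cancelled
by `hreg`; repeating this removes `x_n` from the term. -/
lemma IsHomogeneousIdeal.erase_last_mem_leadExps {I : Ideal (MvPolynomial (Fin (n + 1)) k)}
    (hI : IsHomogeneousIdeal I) (hreg : ∀ f, X (Fin.last n) * f ∈ I → f ∈ I)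
    {a : Fin (n + 1) →₀ ℕ} (ha : a ∈ leadExps (degRevLex (n + 1)) I) :
    a.erase (Fin.last n) ∈ leadExps (degRevLex (n + 1)) I := by
  induction hs : a (Fin.last n) generalizing a with
  | zero => rwa [Finsupp.erase_of_notMem_support (by simpa using hs)]
  | succ s ih =>
    obtain ⟨f, hf, hf0, hfa, hfd⟩ := hI.exists_isHomogeneous ha
    have hdvd : X (Fin.last n) ∣ f := by
      rw [X_last_dvd_iff]
      by_contra h
      have := degree_last_eq_zero hfd h
      rw [hfa] at this
      omega
    obtain ⟨g, rfl⟩ := hdvd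
    have hg0 : g ≠ 0 := right_ne_zero_of_mul hf0
    rw [MonomialOrder.degree_mul (X_ne_zero _) hg0, MonomialOrder.degree_X] at hfa
    have := ih (a := (degRevLex (n + 1)).degree g) ⟨g, hreg g hf, hg0, rfl⟩
      (by rw [← hfa] at hs; simp at hs; omega)
    rw [← hfa]
    convert this using 1
    simp [Finsupp.erase_add, Finsupp.erase_single]

lemma IsHomogeneousIdeal.map_dropLast_ne_bot {I : Ideal (MvPolynomial (Fin (n + 1)) k)}
    (hI : IsHomogeneousIdeal I) (hreg : ∀ f, X (Fin.last n) * f ∈ I → f ∈ I) (h0 : I ≠ ⊥) :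
    I.map (dropLast k n) ≠ ⊥ := by
  obtain ⟨a, ha⟩ := leadExps_nonempty (m := degRevLex (n + 1)) h0
  have h1 := hI.erase_last_mem_leadExps hreg ha
  rw [← snocZero_comapDomain (Finsupp.erase_same (f := a)),
    ← hI.mem_leadExps_map_dropLast] at h1
  obtain ⟨g, hg, hg0, -⟩ := h1
  exact (Submodule.ne_bot_iff _).2 ⟨g, hg, hg0⟩

lemma InQuasiStablePosition.map_dropLast {I : Ideal (MvPolynomial (Fin (n + 1)) k)}
    (hqs : InQuasiStablePosition I) (hI : IsHomogeneousIdeal I) :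
    InQuasiStablePosition (I.map (dropLast k n)) := by
  rw [inQuasiStablePosition_iff] at hqs ⊢
  intro a ha i j hij s hs hsa
  rw [hI.mem_leadExps_map_dropLast] at ha
  obtain ⟨t, ht⟩ := hqs _ ha i.castSucc j.castSucc (by simpa using hij) s hs (by simpa using hsa)
  refine ⟨t, hI.mem_leadExps_map_dropLast.2 ?_⟩
  convert ht using 1
  ext l
  induction l using Fin.lastCases with
  | last => simp
  | cast l =>
    simp only [snocZero_castSucc, Finsupp.add_apply, Finsupp.tsub_apply, Finsupp.single_apply,
      Fin.castSucc_inj]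

lemma IsGeneratedInDegreeLE.map_dropLast {I : Ideal (MvPolynomial (Fin (n + 1)) k)} {d : ℕ}
    (h : IsGeneratedInDegreeLE I d) : IsGeneratedInDegreeLE (I.map (dropLast k n)) d := by
  classical
  obtain ⟨F, hF, rfl⟩ := h
  -- Generators divisible by `x_n` specialize to zero and must be discarded.
  refine ⟨(F.image (dropLast k n)).erase 0, fun g hg => ?_, ?_⟩
  · obtain ⟨hg0, hg⟩ := Finset.mem_erase.1 hg
    obtain ⟨f, hf, rfl⟩ := Finset.mem_image.1 hg
    obtain ⟨-, e, he0, hed, he⟩ := hF f hf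
    exact ⟨hg0, e, he0, hed, he.dropLast⟩
  · rw [Ideal.map_span, Finset.coe_erase, Finset.coe_image, Ideal.span_sdiff_singleton_zero]

/-- The specialization of the reduced Gröbner basis at `0` is the reduced Gröbner basis of the
specialized ideal. -/
lemma IsHomogeneousIdeal.isGroebnerDegree_map_dropLast
    {I : Ideal (MvPolynomial (Fin (n + 1)) k)}
    (hI : IsHomogeneousIdeal I) (hreg : ∀ f, X (Fin.last n) * f ∈ I → f ∈ I) {e : ℕ}
    (he : IsGroebnerDegree (degRevLex (n + 1)) I e) :
    IsGroebnerDegree (degRevLex n) (I.map (dropLast k n)) e := by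
  classical
  obtain ⟨G, hG, hmax⟩ := he
  set m := degRevLex (n + 1)
  have hne : ∀ g ∈ G, g ≠ 0 := fun g hg => (hG.monic g hg).ne_zero
  have hdvd : ∀ a ∈ leadExps m I, ∃ g ∈ G, m.degree g ≤ a := by
    intro a ha
    rw [← monomial_mem_leadingIdeal_iff, hG.span_eq,
      ← Set.image_image (fun s => monomial s (1 : k)) m.degree,
      mem_ideal_span_monomial_image] at ha
    obtain ⟨_, ⟨g, hg, rfl⟩, hle⟩ := ha a (by simp)
    exact ⟨g, hg, hle⟩
  -- Removing `x_n` from the leading term of `g` leaves a term divisible by the leading term of some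
  -- `g'`. Reducedness forces `g' = g`, so there was no `x_n` to remove.
  have hlast : ∀ g ∈ G, ∃ a, m.degree g = snocZero a := by
    intro g hg
    have hgE : m.degree g ∈ leadExps m I := ⟨g, hG.subset g hg, hne g hg, rfl⟩
    obtain ⟨g', hg', hle⟩ := hdvd _ (hI.erase_last_mem_leadExps hreg hgE)
    have heq : g' = g := by
      by_contra hne'
      refine hG.reduced g hg g' hg' hne' _ (m.degree_mem_support (hne g hg)) (hle.trans ?_)
      intro i
      rw [Finsupp.erase_apply]
      split_ifs <;> simp
    subst heq
    have h0 := hle (Fin.last n)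
    rw [Finsupp.erase_same] at h0
    exact ⟨_, (snocZero_comapDomain (Nat.le_zero.1 h0)).symm⟩
  choose! ld hld using hlast
  have hdeg : ∀ g ∈ G, (degRevLex n).degree (dropLast k n g) = ld g := fun g hg =>
    degree_dropLast (hne g hg) (hld g hg)
  refine ⟨G.image (dropLast k n), ⟨?_, ?_, ?_, ?_⟩, ?_⟩
  · intro g hg
    obtain ⟨f, hf, rfl⟩ := Finset.mem_image.1 hg
    exact Ideal.mem_map_of_mem _ (hG.subset f hf)
  · apply le_antisymm
    · rw [leadingIdeal_eq_span, Ideal.span_le]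
      rintro _ ⟨a, ha, rfl⟩
      obtain ⟨g, hg, hle⟩ := hdvd _ (hI.mem_leadExps_map_dropLast.1 ha)
      rw [hld g hg, snocZero_le_iff, ← hdeg g hg] at hle
      refine Ideal.mem_of_dvd _ ?_ (Ideal.subset_span
        ⟨_, Finset.mem_coe.2 (Finset.mem_image_of_mem _ hg), rfl⟩)
      rw [monomial_dvd_monomial]
      exact ⟨Or.inr hle, dvd_rfl⟩
    · rw [Ideal.span_le]
      rintro _ ⟨g, hg, rfl⟩
      obtain ⟨f, hf, rfl⟩ := Finset.mem_image.1 (Finset.mem_coe.1 hg)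
      exact monomial_mem_leadingIdeal_iff.2 ⟨_, Ideal.mem_map_of_mem _ (hG.subset f hf),
        dropLast_ne_zero (hne f hf) (hld f hf), rfl⟩
  · intro g hg
    obtain ⟨f, hf, rfl⟩ := Finset.mem_image.1 hg
    have := hG.monic f hf
    unfold MonomialOrder.Monic MonomialOrder.leadingCoeff at this ⊢
    rw [hdeg f hf, coeff_killCompl]
    rwa [hld f hf] at this
  · intro g hg g' hg' hgg a ha hle
    obtain ⟨f, hf, rfl⟩ := Finset.mem_image.1 hg
    obtain ⟨f', hf', rfl⟩ := Finset.mem_image.1 hg'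
    rw [mem_support_iff, coeff_killCompl, ← mem_support_iff] at ha
    refine hG.reduced f hf f' hf' (fun h => hgg (by rw [h])) _ ha ?_
    rwa [hld f' hf', snocZero_le_iff, ← hdeg f' hf']
  · have htot : ∀ g ∈ G, (dropLast k n g).totalDegree = g.totalDegree := by
      intro g hg
      rw [totalDegree_eq_degree_degRevLex, totalDegree_eq_degree_degRevLex, hdeg g hg, hld g hg,
        Finsupp.degree_mapDomain]
    have hset : {s | ∃ g ∈ G.image (dropLast k n), s = g.totalDegree}
        = {s | ∃ g ∈ G, s = g.totalDegree} := by
      ext s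
      simp only [Finset.mem_image, exists_exists_and_eq_and, Set.mem_ofPred_eq]
      exact exists_congr fun g => and_congr_right fun hg => by rw [htot g hg]
    rwa [hset]

end DropLast

/-! ### Krull dimension through Noether position. -/

section Dimension

/-- Incomparability keeps chains strict under contraction; lying over and going up lift chains from
`R` to `S`. -/
lemma ringKrullDim_eq_of_isIntegral {R S : Type*} [CommRing R] [CommRing S] [Algebra R S]
    [Algebra.IsIntegral R S] (hinj : Function.Injective (algebraMap R S)) :
    ringKrullDim S = ringKrullDim R := by
  apply le_antisymm
  · exact Order.krullDim_le_of_strictMono (PrimeSpectrum.comap (algebraMap R S))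
      fun p q h => Ideal.IsIntegral.comap_lt_comap (R := R) (I := p.asIdeal) (J := q.asIdeal) h
  · refine iSup_le fun l => ?_
    obtain ⟨Q, -, hQ, hQl⟩ := Ideal.exists_ideal_over_prime_of_isIntegral (S := S) l.head.asIdeal ⊥
      (by
        rw [← RingHom.ker_eq_comap_bot, (RingHom.injective_iff_ker_eq_bot _).1 hinj]
        exact bot_le)
    have : Q.LiesOver l.head.asIdeal := ⟨hQl.symm⟩
    obtain ⟨L, hL, -⟩ := Ideal.exists_ltSeries_of_hasGoingUp l Q
    rw [← hL]
    exact le_iSup (fun p : LTSeries (PrimeSpectrum S) => (p.length : WithBot ℕ∞)) L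

variable {k : Type*} [Field k] {n : ℕ}

/-- The indices of the variables of which no power is a leading term. -/
def freeIndices (I : Ideal (MvPolynomial (Fin n) k)) : Set (Fin n) :=
  {i | ∀ s : ℕ, Finsupp.single i s ∉ leadExps (degRevLex n) I}

/-- Quasi stability replaces the full power of `x_i` in a leading term by a power of an `x_j` with
`j < i` already present. This shrinks the support until a pure power is left. -/
lemma InQuasiStablePosition.exists_notMem_freeIndices {I : Ideal (MvPolynomial (Fin n) k)}
    (hqs : InQuasiStablePosition I) (hI : I ≠ ⊤) {a : Fin n →₀ ℕ}
    (ha : a ∈ leadExps (degRevLex n) I) : ∃ i ∈ a.support, i ∉ freeIndices I := by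
  classical
  rw [inQuasiStablePosition_iff] at hqs
  induction hN : a.support.card using Nat.strong_induction_on generalizing a with
  | _ N ih =>
    subst hN
    by_cases h : ∃ i ∈ a.support, ∃ j ∈ a.support, j < i
    · obtain ⟨i, hi, j, hj, hji⟩ := h
      obtain ⟨t, ht⟩ := hqs a ha i j hji (a i) (Nat.pos_of_ne_zero (by simpa using hi)) le_rfl
      have hsub : (a - Finsupp.single i (a i) + Finsupp.single j t).support ⊆
          a.support.erase i := by
        intro l hl
        rw [Finset.mem_erase]
        rw [Finsupp.mem_support_iff, Finsupp.add_apply, Finsupp.tsub_apply] at hl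
        refine ⟨?_, ?_⟩
        · rintro rfl
          simp [Finsupp.single_eq_of_ne hji.ne'] at hl
        · rcases eq_or_ne l j with rfl | hlj
          · exact hj
          · rw [Finsupp.single_eq_of_ne hlj, add_zero] at hl
            exact Finsupp.mem_support_iff.2 fun h0 => hl (by simp [h0])
      obtain ⟨l, hl, hl'⟩ := ih _ ((Finset.card_le_card hsub).trans_lt
        (Finset.card_erase_lt_of_mem hi)) ht rfl
      exact ⟨l, Finset.mem_of_mem_erase (hsub hl), hl'⟩
    · push Not at h
      have ha0 : a ≠ 0 := fun h0 => zero_notMem_leadExps hI (h0 ▸ ha)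
      obtain ⟨i, hi⟩ := Finsupp.support_nonempty_iff.2 ha0
      refine ⟨i, hi, fun hfree => hfree (a i) ?_⟩
      convert ha using 1
      ext l
      rcases eq_or_ne l i with rfl | hl
      · simp
      · rw [Finsupp.single_eq_of_ne hl]
        by_contra h0
        have hl' : l ∈ a.support := Finsupp.mem_support_iff.2 (Ne.symm h0)
        exact hl (le_antisymm (h l hl' i hi) (h i hi l hl'))

/-- A proper ideal in quasi stable position is in Noether position: its factor ring is a finite
extension of the polynomial ring in the variables of which no power is a leading term. -/
lemma InQuasiStablePosition.ringKrullDim_quotient {I : Ideal (MvPolynomial (Fin n) k)}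
    (hqs : InQuasiStablePosition I) (hI : I ≠ ⊤) :
    ringKrullDim (MvPolynomial (Fin n) k ⧸ I) = (freeIndices I).ncard := by
  classical
  set m := degRevLex n
  set T := freeIndices I
  let φ : MvPolynomial T k →+* MvPolynomial (Fin n) k ⧸ I :=
    (Ideal.Quotient.mk I).comp (rename ((↑) : T → Fin n)).toRingHom
  let : Algebra (MvPolynomial T k) (MvPolynomial (Fin n) k ⧸ I) := φ.toAlgebra
  let : Module (MvPolynomial T k) (MvPolynomial (Fin n) k ⧸ I) := Algebra.toModule
  have hφ : ∀ p, algebraMap (MvPolynomial T k) (MvPolynomial (Fin n) k ⧸ I) p =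
    Ideal.Quotient.mk I (rename (↑) p) := fun _ => rfl
  have hsmul : ∀ p (q : MvPolynomial (Fin n) k), p • Ideal.Quotient.mk I q =
      Ideal.Quotient.mk I (rename ((↑) : T → Fin n) p * q) := fun p q => by
    rw [Algebra.smul_def, hφ, map_mul]
  -- A non-zero relation among the free variables would have a leading term in these variables
  -- alone.
  have hinj : Function.Injective (algebraMap (MvPolynomial T k) (MvPolynomial (Fin n) k ⧸ I)) := by
    rw [injective_iff_map_eq_zero]
    intro p hp
    rw [hφ, Ideal.Quotient.eq_zero_iff_mem] at hp
    by_contra hp0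
    have hr0 : rename ((↑) : T → Fin n) p ≠ 0 :=
      (rename_eq_zero_iff_of_injective p Subtype.val_injective).not.2 hp0
    obtain ⟨i, hi, hiT⟩ := hqs.exists_notMem_freeIndices hI ⟨_, hp, hr0, rfl⟩
    have hs := m.degree_mem_support hr0
    rw [support_rename_of_injective Subtype.val_injective] at hs
    obtain ⟨b, -, hb⟩ := Finset.mem_image.1 hs
    rw [← hb] at hi
    obtain ⟨j, -, rfl⟩ := Finset.mem_image.1 (Finsupp.mapDomain_support hi)
    exact hiT j.2
  have hpow : ∀ i, ∃ s : ℕ, i ∉ T → Finsupp.single i s ∈ leadExps m I := by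
    intro i
    by_cases hi : i ∈ T
    · exact ⟨0, fun h => absurd hi h⟩
    · simp only [T, freeIndices, Set.mem_ofPred_eq, not_forall, not_not] at hi
      exact hi.imp fun s hs _ => hs
  choose s hs using hpow
  -- The values of `s` at free indices are arbitrary; only finiteness of the box matters there.
  set B : Set (MvPolynomial (Fin n) k ⧸ I) :=
    (fun b => Ideal.Quotient.mk I (monomial b 1)) '' Set.Iic (Finsupp.equivFunOnFinite.symm s)
  have hB : B.Finite := (Set.finite_Iic _).image _
  set N := Submodule.span (MvPolynomial T k) B
  have hC : ∀ (c : k) (f : MvPolynomial (Fin n) k), Ideal.Quotient.mk I f ∈ N →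
      Ideal.Quotient.mk I (C c * f) ∈ N := fun c f hf => by
    have := N.smul_mem (C c) hf
    rwa [hsmul, rename_C] at this
  -- Well-founded induction on terms: a leading term is congruent to a combination of smaller terms.
  -- Any other term is a product of free variables, acting as a scalar, and a non-free part whose
  -- exponents lie below `s`.
  have hmon : ∀ a, Ideal.Quotient.mk I (monomial a 1) ∈ N := by
    intro a
    induction ha : m.toSyn a using WellFoundedLT.induction generalizing a with
    | ind x ih =>
      subst ha
      by_cases haE : a ∈ leadExps m I
      · obtain ⟨g, hg, hg0, rfl⟩ := haE
        have hlc : m.leadingCoeff g ≠ 0 := m.leadingCoeff_ne_zero_iff.2 hg0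
        have hsum := g.support_sum_monomial_coeff
        rw [← Finset.add_sum_erase _ _ (m.degree_mem_support hg0)] at hsum
        have hrest : Ideal.Quotient.mk I
            (∑ c ∈ g.support.erase (m.degree g), monomial c (coeff c g)) ∈ N := by
          rw [map_sum]
          refine N.sum_mem fun c hc => ?_
          have hlt : m.toSyn c < m.toSyn (m.degree g) :=
            lt_of_le_of_ne (m.le_degree (Finset.mem_of_mem_erase hc))
              (m.toSyn.injective.ne (Finset.ne_of_mem_erase hc))
          have := hC (coeff c g) _ (ih _ hlt c rfl)
          rwa [C_mul_monomial, mul_one] at this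
        have heq : Ideal.Quotient.mk I (monomial (m.degree g) (m.leadingCoeff g)) =
            -Ideal.Quotient.mk I
              (∑ c ∈ g.support.erase (m.degree g), monomial c (coeff c g)) := by
          rw [eq_neg_iff_add_eq_zero, ← map_add, Ideal.Quotient.eq_zero_iff_mem]
          rwa [show m.leadingCoeff g = coeff (m.degree g) g from rfl, hsum]
        have := hC (m.leadingCoeff g)⁻¹ _ (heq.symm ▸ N.neg_mem hrest)
        rwa [C_mul_monomial, inv_mul_cancel₀ hlc] at this
      · have hb : a.filter (· ∉ T) ≤ Finsupp.equivFunOnFinite.symm s := by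
          intro i
          rw [Finsupp.filter_apply]
          split_ifs with hi
          · exact Nat.zero_le _
          · by_contra! hlt
            refine haE (leadExps_mono_mem (hs i hi) ?_)
            rw [Finsupp.single_le_iff]
            exact hlt.le
        have hc : Finsupp.mapDomain ((↑) : T → Fin n)
            ((a.filter (· ∈ T)).comapDomain (↑) Subtype.val_injective.injOn) =
              a.filter (· ∈ T) := by
          refine Finsupp.mapDomain_comapDomain _ Subtype.val_injective _ ?_
          intro i hi
          simp only [Finsupp.support_filter, Finset.coe_filter, Set.mem_ofPred_eq] at hi
          exact ⟨⟨i, hi.2⟩, rfl⟩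
        have := N.smul_mem (monomial
            ((a.filter (· ∈ T)).comapDomain (↑) Subtype.val_injective.injOn) 1)
          (Submodule.subset_span ⟨_, hb, rfl⟩)
        rwa [hsmul, rename_monomial, hc, monomial_mul, mul_one,
          Finsupp.filter_add_filter_not] at this
  have hfin : Module.Finite (MvPolynomial T k) (MvPolynomial (Fin n) k ⧸ I) := by
    refine ⟨⟨hB.toFinset, ?_⟩⟩
    rw [Set.Finite.coe_toFinset, eq_top_iff]
    rintro x -
    obtain ⟨f, rfl⟩ := Ideal.Quotient.mk_surjective x
    rw [← f.support_sum_monomial_coeff, map_sum]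
    refine N.sum_mem fun c _ => ?_
    have := hC (coeff c f) _ (hmon c)
    rwa [C_mul_monomial, mul_one] at this
  rw [ringKrullDim_eq_of_isIntegral hinj, MvPolynomial.ringKrullDim_of_isNoetherianRing,
    ringKrullDim_eq_zero_of_field, zero_add, Nat.card_coe_set_eq]

/-- If a power of `x_n` were a leading term, erasing `x_n` would make `1` one. -/
lemma freeIndices_eq_insert {I : Ideal (MvPolynomial (Fin (n + 1)) k)}
    (hI : IsHomogeneousIdeal I) (hreg : ∀ f, X (Fin.last n) * f ∈ I → f ∈ I) (htop : I ≠ ⊤) :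
    freeIndices I = insert (Fin.last n) (Fin.castSucc '' freeIndices (I.map (dropLast k n))) := by
  ext i
  induction i using Fin.lastCases with
  | last =>
    simp only [Set.mem_insert_iff, true_or, iff_true]
    intro s hs
    have := hI.erase_last_mem_leadExps hreg hs
    rw [Finsupp.erase_single] at this
    exact zero_notMem_leadExps htop this
  | cast i =>
    rw [Set.mem_insert_iff, or_iff_right (Fin.castSucc_lt_last i).ne,
      (Fin.castSucc_injective n).mem_set_image]
    refine forall_congr' fun s => ?_
    rw [hI.mem_leadExps_map_dropLast, snocZero, Finsupp.mapDomain_single]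

lemma InQuasiStablePosition.ringKrullDim_map_dropLast
    {I : Ideal (MvPolynomial (Fin (n + 1)) k)} (hqs : InQuasiStablePosition I)
    (hI : IsHomogeneousIdeal I) (hreg : ∀ f, X (Fin.last n) * f ∈ I → f ∈ I)
    (htop : I ≠ ⊤) (htop' : I.map (dropLast k n) ≠ ⊤) {D : ℕ}
    (hD : ringKrullDim (MvPolynomial (Fin (n + 1)) k ⧸ I) = D) :
    ∃ D', D = D' + 1 ∧ ringKrullDim (MvPolynomial (Fin n) k ⧸ I.map (dropLast k n)) = D' := by
  refine ⟨_, ?_, (hqs.map_dropLast hI).ringKrullDim_quotient htop'⟩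
  rw [hqs.ringKrullDim_quotient htop, freeIndices_eq_insert hI hreg htop,
    Set.ncard_insert_of_notMem (by simp [Fin.castSucc_ne_last]),
    Set.ncard_image_of_injective _ (Fin.castSucc_injective n)] at hD
  exact_mod_cast hD.symm

end Dimension

/-! ### Regular sequences modulo the last variable. -/

section RegularSequence

open RingTheory.Sequence CategoryTheory Abelian Pointwise

universe u

/-- If the ideal `J` contains an `M`-regular sequence of length `l + 1` and the `M`-regular
element `x`, then it contains an `M / x M`-regular sequence of length `l`. -/
lemma exists_isRegular_quotSMulTop {R : Type u} [CommRing R] [IsNoetherianRing R] (J : Ideal R)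
    (M : Type u) [AddCommGroup M] [Module R M] [Module.Finite R M]
    {x : R} (hxJ : x ∈ J) (hx : IsSMulRegular M x) (hJ : J • (⊤ : Submodule R M) ≠ ⊤)
    {ys : List R} {l : ℕ} (hl : ys.length = l + 1) (hys : ∀ y ∈ ys, y ∈ J) (hreg : IsRegular M ys) :
    ∃ zs : List R, zs.length = l ∧ (∀ z ∈ zs, z ∈ J) ∧ IsRegular (QuotSMulTop x M) zs := by
  have hJx : J • (⊤ : Submodule R (QuotSMulTop x M)) ≠ ⊤ := by
    intro eq
    absurd congrArg (Submodule.comap (Submodule.mkQ _)) eq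
    simpa [Submodule.comap_smul_top_of_surjective J _ (Submodule.mkQ_surjective _),
      Submodule.smul_mono_left ((Ideal.span_singleton_le_iff_mem J).mpr hxJ),
      ← Submodule.ideal_span_singleton_smul] using hJ
  -- By Rees's criterion, a regular sequence of length `l + 1` in `J` amounts to the vanishing of
  -- `Ext^i(R/J, M)` for `i ≤ l`. In the long exact sequence of `0 → M → M → M/xM → 0`, the group
  -- `Ext^i(R/J, M/xM)` sits between those of `M` in degrees `i` and `i + 1`.
  have h : ∀ i < l + 1, Subsingleton
      (Ext (ModuleCat.of R (Shrink.{u} (R ⧸ J))) (ModuleCat.of R M) i) := by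
    have := (ModuleCat.exists_isRegular_tfae J (l + 1) (ModuleCat.of R M) hJ.lt_top).out 3 1
    exact this.1 ⟨ys, hl, hys, hreg⟩
  refine ((ModuleCat.exists_isRegular_tfae J l
    (ModuleCat.of R (QuotSMulTop x M)) hJx.lt_top).out 1 3).1 fun i hi => ?_
  have zero1 := AddCommGrpCat.isZero_of_iff_subsingleton.mpr (h i (by omega))
  have zero2 := AddCommGrpCat.isZero_of_iff_subsingleton.mpr (h (i + 1) (by omega))
  exact AddCommGrpCat.subsingleton_of_isZero <| ShortComplex.Exact.isZero_of_both_zeros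
    ((Ext.covariant_sequence_exact₃' _
      (IsSMulRegular.smulShortComplex_shortExact (M := ModuleCat.of R M) hx)) i (i + 1) rfl)
    (zero1.eq_zero_of_src _) (zero2.eq_zero_of_tgt _)

/-- The projection `R ⧸ I → R ⧸ J` kills `J • ⊤` but not the class of `1`. -/
lemma Ideal.smul_top_quotient_ne_top {R : Type*} [CommRing R] {I J : Ideal R} (hIJ : I ≤ J)
    (hJ : J ≠ ⊤) : J • (⊤ : Submodule R (R ⧸ I)) ≠ ⊤ := by
  intro h
  have hle : J • (⊤ : Submodule R (R ⧸ I)) ≤ LinearMap.ker (Submodule.factor hIJ) := by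
    refine Submodule.smul_le.2 fun r hr m _ => ?_
    obtain ⟨p, rfl⟩ := Ideal.Quotient.mk_surjective m
    rw [LinearMap.mem_ker, map_smul]
    change Ideal.Quotient.mk J (r * p) = 0
    exact Ideal.Quotient.eq_zero_iff_mem.2 (J.mul_mem_right _ hr)
  have h1 : Ideal.Quotient.mk I 1 ∈ LinearMap.ker (Submodule.factor hIJ) :=
    hle (by rw [h]; exact Submodule.mem_top)
  exact (Ideal.ne_top_iff_one J).1 hJ (Ideal.Quotient.eq_zero_iff_mem.1 h1)

lemma isSMulRegular_quotient_iff {R : Type*} [CommRing R] {I : Ideal R} {x : R} :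
    IsSMulRegular (R ⧸ I) x ↔ ∀ f, x * f ∈ I → f ∈ I := by
  rw [isSMulRegular_iff_right_eq_zero_of_smul, Ideal.Quotient.mk_surjective.forall]
  refine forall_congr' fun f => ?_
  rw [Algebra.smul_def, Ideal.Quotient.algebraMap_eq, ← map_mul, Ideal.Quotient.eq_zero_iff_mem,
    Ideal.Quotient.eq_zero_iff_mem]

variable {k : Type*} [Field k] {n : ℕ}

/-- Killing `x_n` in the factor ring by `I` gives the factor ring by the image ideal. The bijection
is semilinear over `dropLast`, which suffices to transport regularity. -/
lemma isRegular_map_dropLast {I : Ideal (MvPolynomial (Fin (n + 1)) k)}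
    {zs : List (MvPolynomial (Fin (n + 1)) k)}
    (h : IsRegular (QuotSMulTop (X (Fin.last n) : MvPolynomial (Fin (n + 1)) k)
      (MvPolynomial (Fin (n + 1)) k ⧸ I)) zs) :
    IsRegular (MvPolynomial (Fin n) k ⧸ I.map (dropLast k n)) (zs.map (dropLast k n)) := by
  let σ : MvPolynomial (Fin (n + 1)) k →+* MvPolynomial (Fin n) k := (dropLast k n).toRingHom
  let f : MvPolynomial (Fin (n + 1)) k ⧸ I →+* MvPolynomial (Fin n) k ⧸ I.map (dropLast k n) :=
    Ideal.quotientMap _ σ Ideal.le_comap_map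
  let ψ : (MvPolynomial (Fin (n + 1)) k ⧸ I) →ₛₗ[σ]
      (MvPolynomial (Fin n) k ⧸ I.map (dropLast k n)) :=
    { toFun := f
      map_add' := map_add f
      map_smul' := fun r m => by
        obtain ⟨p, rfl⟩ := Ideal.Quotient.mk_surjective m
        exact map_mul f (Ideal.Quotient.mk I r) (Ideal.Quotient.mk I p) }
  have hX : dropLast k n (X (Fin.last n)) = 0 := X_last_dvd_iff.1 dvd_rfl
  have hker : (X (Fin.last n) : MvPolynomial (Fin (n + 1)) k) • (⊤ : Submodule (MvPolynomial (Fin (n + 1)) k)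
      (MvPolynomial (Fin (n + 1)) k ⧸ I)) ≤ LinearMap.ker ψ := by
    intro m hm
    obtain ⟨q, -, rfl⟩ := (Submodule.mem_smul_pointwise_iff_exists _ _ _).1 hm
    rw [LinearMap.mem_ker, map_smulₛₗ]
    change dropLast k n (X (Fin.last n)) • _ = _
    rw [hX, zero_smul]
  let e := Submodule.liftQ _ ψ hker
  have he : Function.Bijective e := by
    constructor
    · rw [injective_iff_map_eq_zero]
      intro m hm
      obtain ⟨m, rfl⟩ := Submodule.mkQ_surjective _ m
      obtain ⟨p, rfl⟩ := Ideal.Quotient.mk_surjective m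
      have hm : Ideal.Quotient.mk (I.map (dropLast k n)) (dropLast k n p) = 0 := hm
      rw [Ideal.Quotient.eq_zero_iff_mem, mem_map_dropLast] at hm
      obtain ⟨g, hg, hgp⟩ := hm
      obtain ⟨q, hq⟩ := X_last_dvd_iff.2
        (show dropLast k n (p - g) = 0 by rw [map_sub, hgp, sub_self])
      rw [Submodule.mkQ_apply, Submodule.Quotient.mk_eq_zero]
      refine (Submodule.mem_smul_pointwise_iff_exists _ _ _).2
        ⟨Ideal.Quotient.mk I q, Submodule.mem_top, ?_⟩
      change Ideal.Quotient.mk I (X (Fin.last n) * q) = Ideal.Quotient.mk I p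
      rw [← hq, map_sub, Ideal.Quotient.eq_zero_iff_mem.2 hg, sub_zero]
    · intro m
      obtain ⟨p, rfl⟩ := Ideal.Quotient.mk_surjective m
      obtain ⟨q, rfl⟩ := dropLast_surjective p
      exact ⟨Submodule.mkQ _ (Ideal.Quotient.mk I q), rfl⟩
  refine ((AddEquiv.ofBijective e he).isRegular_congr ?_).1 h
  exact List.forall₂_map_right_iff.2 (List.forall₂_same.2 fun r _ m => map_smulₛₗ e r m)

end RegularSequence

/-! ### The induction and the theorem. -/

/-- The sequence is taken in the ideal of the variables instead of among linear forms, since the Ext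
criterion gives no control over the degrees of the new sequence. -/
lemma groebnerDegree_le_of_isRegular {k : Type*} [Field k] {U : ℕ → ℕ → ℕ → ℝ}
    (hU : ∀ (n d D : ℕ) (I : Ideal (MvPolynomial (Fin n) k)), I ≠ ⊥ →
      IsGeneratedInDegreeLE I d → InQuasiStablePosition I →
      ringKrullDim (MvPolynomial (Fin n) k ⧸ I) = D →
      ∀ e : ℕ, IsGroebnerDegree (degRevLex n) I e → (e : ℝ) ≤ U n d D)
    {n d D : ℕ} {I : Ideal (MvPolynomial (Fin n) k)} (hI : I ≠ ⊥)
    (hgen : IsGeneratedInDegreeLE I d) (hqs : InQuasiStablePosition I)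
    (hdim : ringKrullDim (MvPolynomial (Fin n) k ⧸ I) = D)
    {ys : List (MvPolynomial (Fin n) k)} (hys : ∀ y ∈ ys, y ∈ idealOfVars (Fin n) k)
    (hreg : RingTheory.Sequence.IsRegular (MvPolynomial (Fin n) k ⧸ I) ys) :
    ys.length ≤ D ∧ ∀ e : ℕ, IsGroebnerDegree (degRevLex n) I e →
      (e : ℝ) ≤ U (n - ys.length) d (D - ys.length) := by
  induction hl : ys.length generalizing n D I ys with
  | zero => exact ⟨Nat.zero_le _, hU n d D I hI hgen hqs hdim⟩
  | succ l ih =>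
    obtain - | n := n
    -- Without variables the ideal of the variables is zero, which forces `I = ⊥`.
    · refine absurd (le_bot_iff.1 (hgen.le_idealOfVars.trans ?_)) hI
      simp [idealOfVars]
    obtain - | ⟨y, ys'⟩ := ys
    · simp at hl
    have hhom := hgen.isHomogeneousIdeal
    have hX : (X (Fin.last n) : MvPolynomial (Fin (n + 1)) k) ∈ idealOfVars _ k :=
      Ideal.subset_span ⟨_, rfl⟩
    have hlast : ∀ f, X (Fin.last n) * f ∈ I → f ∈ I := fun f =>
      hqs.mem_of_X_last_mul_mem hhom (hys y List.mem_cons_self)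
        (isSMulRegular_quotient_iff.1
          ((RingTheory.Sequence.isRegular_cons_iff _ _ _).1 hreg).1)
    obtain ⟨zs, hzl, hz, hzreg⟩ := exists_isRegular_quotSMulTop (idealOfVars (Fin (n + 1)) k) _ hX
      (isSMulRegular_quotient_iff.2 hlast)
      (Ideal.smul_top_quotient_ne_top hgen.le_idealOfVars idealOfVars_ne_top) hl hys hreg
    have hgen' := hgen.map_dropLast
    obtain ⟨D', rfl, hD'⟩ := hqs.ringKrullDim_map_dropLast hhom hlast
      (ne_top_of_le_ne_top idealOfVars_ne_top hgen.le_idealOfVars)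
      (ne_top_of_le_ne_top idealOfVars_ne_top hgen'.le_idealOfVars) hdim
    obtain ⟨h1, h2⟩ := ih (hhom.map_dropLast_ne_bot hlast hI) hgen' (hqs.map_dropLast hhom) hD'
      (ys := zs.map (dropLast k n)) (fun w hw => by
        obtain ⟨z, hzs, rfl⟩ := List.mem_map.1 hw
        have := mem_idealOfVars_iff.1 (hz z hzs)
        rw [mem_idealOfVars_iff, constantCoeff_eq, coeff_killCompl]
        simpa [constantCoeff_eq] using this)
      (isRegular_map_dropLast hzreg) (by simpa using hzl)
    refine ⟨by omega, fun e he => ?_⟩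
    rw [Nat.add_sub_add_right, Nat.add_sub_add_right]
    exact h2 e (hhom.isGroebnerDegree_map_dropLast hlast he)

theorem mainTheorem8 {k : Type*} [Field k] [CharZero k] (U : ℕ → ℕ → ℕ → ℝ)
    (hU : ∀ (n d D : ℕ) (I : Ideal (MvPolynomial (Fin n) k)), I ≠ ⊥ →
      IsGeneratedInDegreeLE I d → InQuasiStablePosition I →
      ringKrullDim (MvPolynomial (Fin n) k ⧸ I) = D →
      ∀ e : ℕ, IsGroebnerDegree (degRevLex n) I e → (e : ℝ) ≤ U n d D)
    (n d D l : ℕ) (I : Ideal (MvPolynomial (Fin n) k)) (hI : I ≠ ⊥)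
    (hgen : IsGeneratedInDegreeLE I d) (hqs : InQuasiStablePosition I)
    (hdim : ringKrullDim (MvPolynomial (Fin n) k ⧸ I) = D) (hdepth : IsDepth I l) :
    l ≤ D ∧ D ≤ n ∧
      ∀ e : ℕ, IsGroebnerDegree (degRevLex n) I e → (e : ℝ) ≤ U (n - l) d (D - l) := by
  obtain ⟨⟨ys, rfl, hlin, hreg⟩, -⟩ := hdepth
  obtain ⟨h1, h2⟩ := groebnerDegree_le_of_isRegular hU hI hgen hqs hdim
    (fun y hy => (hlin y hy).mem_idealOfVars one_pos) hreg
  refine ⟨h1, ?_, h2⟩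
  have h := ringKrullDim_quotient_le I
  rw [hdim, MvPolynomial.ringKrullDim_of_isNoetherianRing, ringKrullDim_eq_zero_of_field,
    zero_add, Nat.card_eq_fintype_card, Fintype.card_fin] at h
  exact_mod_cast h
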